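/- **Definitions.** Composition is written in diagrammatic order: $f;g$ means first $f$, then $g$. Sets and the categories in $\mathrm{Cat}$ are small with respect to a universe large enough to contain the objects and morphisms of $\mathcal D$ and the morphisms of $\mathcal T$. Let $\mathbf t:\mathcal D\to\mathcal T$ be a functor between monoidal categories. An object $P\in\mathcal D$ *refines* $A\in\mathcal T$, written $P\sqsubset A$, if $\mathbf t(P)=A$; a *derivation* of $P\Rightarrow_c Q$ is a morphism $\alpha:P\to Q$ with $\mathbf t(\alpha)=c$. A *left residual* of $R$ by $P$ is an object $P\backslash R$ with a morphism $\mathrm{plug}:P\otimes(P\backslash R)\to R$ such that every $f:P\otimes Y\to R$ equals $(P\otimes g);\mathrm{plug}$ for a unique $g:Y\to P\backslash R$; *right residuals* $R/Q$, with $\mathrm{plug}:(R/Q)\otimes Q\to R$, are defined symmetrically. $\mathbf t$ is a *logical refinement system* if it is strict monoidal and preserves (together with the plug maps) all left and right residuals that exist in $\mathcal D$. Let $\mathbf u:\mathrm{Psh}\to\mathrm{Cat}$ be the forgetful functor, where an object of $\mathrm{Psh}$ is a category $\mathcal A$ with a presheaf $\phi:\mathcal A^{op}\to\mathrm{Set}$,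 and a morphism $(\mathcal A,\phi)\to(\mathcal B,\psi)$ is a functor $F:\mathcal A\to\mathcal B$ with a natural transformation $\phi\Rightarrow\psi\circ F^{op}$. For presheaves $\phi$ on $\mathcal A$, $\psi$ on $\mathcal B$, $\omega$ on $\mathcal C$ and a functor $F:\mathcal A\to\mathcal B$, put - $\phi\otimes\psi:(a,b)\mapsto\phi(a)\times\psi(b)$, a presheaf on $\mathcal A\times\mathcal B$; - $\phi\backslash\omega$ and $\omega/\phi$, both the presheaf $G\mapsto\mathrm{Nat}(\phi,\omega\circ G^{op})$ on the functor category $[\mathcal A,\mathcal C]$; - $F^*\psi:a\mapsto\psi(Fa)$, with its canonical morphism $F^*\psi\to\psi$ over $F$; - $F_*\phi:b\mapsto\int^{a}\mathcal B(b,Fa)\times\phi(a)$, with its canonical morphism $\phi\to F_*\phi$ over $F$. A *vertical isomorphism* between presheaves on the same category is an isomorphism in $\mathrm{Psh}$ lying over the identity functor. For $B\in\mathcal T$, let $B^+$ be the category whose objects are pairs $(P,c)$ with $P\in\mathcal D$ and $c:\mathbf t(P)\to B$, and whose morphisms $(P_1,c_1)\to(P_2,c_2)$ are the $\alpha:P_1\to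 P_2$ with $c_1=\mathbf t(\alpha);c_2$. For $c:B\to C$ let $c^+:B^+\to C^+$ be $(P,d)\mapsto(P,d;c)$. For $Q\sqsubset B$, let $Q^+$ be the presheaf on $B^+$ sending $(P,c)$ to the set of derivations of $P\Rightarrow_c Q$; a derivation $\alpha$ of $Q\Rightarrow_c R$ induces $\alpha^+:Q^+\to R^+$ over $c^+$ by postcomposition. For $\mathbf t$ strict monoidal, let $m_{A,B}:A^+\times B^+\to(A\otimes B)^+$ be $((P,c),(Q,d))\mapsto(P\otimes Q,c\otimes d)$, and for $P\sqsubset A$, $Q\sqsubset B$ let $m_{P,Q}:P^+\otimes Q^+\to(P\otimes Q)^+$ be the morphism over $m_{A,B}$ given by $(\alpha,\beta)\mapsto\alpha\otimes\beta$. When the residual $P\backslash R\sqsubset A\backslash C$ exists (with plug maps one over the other), let $\ell_{A,C}:(A\backslash C)^+\to[A^+,C^+]$ and, over it, $\ell_{P,R}:(P\backslash R)^+\to P^+\backslash R^+$ be the left curryings of $m_{A,A\backslash C};\mathrm{plug}^+$ and of $m_{P,P\backslash R};\mathrm{plug}^+$. When $R/Q\sqsubset C/B$ exists, let $r_{B,C}:(C/B)^+\to[B^+,C^+]$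 and $r_{Q,R}:(R/Q)^+\to R^+/Q^+$ be the right curryings of $m_{C/B,B};\mathrm{plug}^+$ and of $m_{R/Q,Q};\mathrm{plug}^+$. **Proposition (generalized Day embedding).** Let $\mathbf t:\mathcal D\to\mathcal T$ be a logical refinement system and let $P\sqsubset A$, $Q\sqsubset B$, $R\sqsubset C$. (a) $m_{P,Q}$ is opcartesian over $m_{A,B}$ relative to $\mathbf u$, and there is a vertical isomorphism $(m_{A,B})_*(P^+\otimes Q^+)\cong(P\otimes Q)^+$ compatible with $m_{P,Q}$ and the canonical morphism $P^+\otimes Q^+\to(m_{A,B})_*(P^+\otimes Q^+)$. (b) If a left residual $P\backslash R$ exists in $\mathcal D$, then $\ell_{P,R}$ is cartesian over $\ell_{A,C}$ relative to $\mathbf u$, and there is a vertical isomorphism $(P\backslash R)^+\cong\ell_{A,C}^{\,*}(P^+\backslash R^+)$ compatible with $\ell_{P,R}$ and the canonical morphism $\ell_{A,C}^{\,*}(P^+\backslash R^+)\to P^+\backslash R^+$. (c) If a right residual $R/Q$ exists in $\mathcal D$, then $r_{Q,R}$ is cartesian over $r_{B,C}$ relative to $\mathbf u$, and there is a vertical isomorphism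 $(R/Q)^+\cong r_{B,C}^{\,*}(R^+/Q^+)$ compatible with $r_{Q,R}$ and the canonical morphism $r_{B,C}^{\,*}(R^+/Q^+)\to R^+/Q^+$. Here (op)cartesian is meant in the strong sense, i.e. with the universal property for morphisms lying over arbitrary composites. -/

import Mathlib

open CategoryTheory MonoidalCategory Opposite

universe w v₁ v₂ u₁ u₂

namespace RefSys

/-! ### Residuals in a monoidal category -/

section Residuals

variable {C : Type u₁} [Category.{v₁} C] [MonoidalCategory C]

/-- `plug : P ⊗ X ⟶ R` exhibits `X` as the left residual `P \ R`: every `f : P ⊗ Y ⟶ R` is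
`P ◁ g ≫ plug` for a unique `g : Y ⟶ X`. -/
def IsLeftResidual {P R X : C} (plug : P ⊗ X ⟶ R) : Prop :=
  ∀ (Y : C) (f : P ⊗ Y ⟶ R), ∃! g : Y ⟶ X, P ◁ g ≫ plug = f

/-- `plug : X ⊗ Q ⟶ R` exhibits `X` as the right residual `R / Q`: every `f : Y ⊗ Q ⟶ R` is
`g ▷ Q ≫ plug` for a unique `g : Y ⟶ X`. -/
def IsRightResidual {Q R X : C} (plug : X ⊗ Q ⟶ R) : Prop :=
  ∀ (Y : C) (f : Y ⊗ Q ⟶ R), ∃! g : Y ⟶ X, g ▷ Q ≫ plug = f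

end Residuals

/-! ### Logical refinement systems -/

section Logical

variable {D : Type u₁} [Category.{v₁} D] {T : Type u₂} [Category.{v₂} T]
  [MonoidalCategory D] [MonoidalCategory T]

/-- A monoidal refinement system: the functor `t` is strict monoidal, i.e. it preserves the tensor
product, the unit and the structural isomorphisms on the nose. -/
structure IsMonoidalRefinement (t : D ⥤ T) : Prop where
  tensor_obj (P Q : D) : t.obj (P ⊗ Q) = t.obj P ⊗ t.obj Q
  unit_obj : t.obj (𝟙_ D) = 𝟙_ T
  tensor_map {P P' Q Q' : D} (f : P ⟶ P') (g : Q ⟶ Q') :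
    t.map (f ⊗ₘ g) = eqToHom (tensor_obj P Q) ≫ (t.map f ⊗ₘ t.map g) ≫
      eqToHom (tensor_obj P' Q').symm
  associator (P Q R : D) : t.IsHomLift (α_ (t.obj P) (t.obj Q) (t.obj R)).hom (α_ P Q R).hom
  leftUnitor (P : D) : t.IsHomLift (λ_ (t.obj P)).hom (λ_ P).hom
  rightUnitor (P : D) : t.IsHomLift (ρ_ (t.obj P)).hom (ρ_ P).hom

/-- A logical refinement system: a monoidal refinement system which preserves all the left and
right residuals that exist in its domain. -/
structure IsLogicalRefinement (t : D ⥤ T) : Prop extends IsMonoidalRefinement t where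
  leftResidual {P R X : D} (plug : P ⊗ X ⟶ R) : IsLeftResidual plug →
    IsLeftResidual (eqToHom (tensor_obj P X).symm ≫ t.map plug)
  rightResidual {Q R X : D} (plug : X ⊗ Q ⟶ R) : IsRightResidual plug →
    IsRightResidual (eqToHom (tensor_obj X Q).symm ≫ t.map plug)

variable {t : D ⥤ T}

theorem IsMonoidalRefinement.isHomLift_tensor (ht : IsMonoidalRefinement t)
    {P P' Q Q' : D} {B B' : T} (c : t.obj P ⟶ B) (d : t.obj Q ⟶ B') (f : P ⟶ P') (g : Q ⟶ Q')
    (hf : t.IsHomLift c f) (hg : t.IsHomLift d g) :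
    t.IsHomLift (eqToHom (ht.tensor_obj P Q) ≫ (c ⊗ₘ d)) (f ⊗ₘ g) := by
  have hB := IsHomLift.codomain_eq t c f
  have hB' := IsHomLift.codomain_eq t d g
  subst hB hB'
  obtain rfl := IsHomLift.eq_of_isHomLift t c f
  obtain rfl := IsHomLift.eq_of_isHomLift t d g
  refine IsHomLift.of_fac _ _ _ rfl (ht.tensor_obj P' Q') ?_
  simp [ht.tensor_map]

/-- The tensor product of refinements `P ⊏ A` and `Q ⊏ B`, a refinement of `A ⊗ B`. -/
def IsMonoidalRefinement.tensor (ht : IsMonoidalRefinement t) {A B : T}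
    (P : t.Fiber A) (Q : t.Fiber B) : t.Fiber (A ⊗ B) :=
  ⟨P.1 ⊗ Q.1, by rw [ht.tensor_obj, P.2, Q.2]⟩

end Logical

/-! ### The refinement system of presheaves -/

/-- A (small) category equipped with a presheaf. -/
structure Psh : Type (w + 1) where
  base : Cat.{w, w}
  psh : baseᵒᵖ ⥤ Type w

namespace Psh

/-- A morphism `(𝒜, φ) ⟶ (ℬ, ψ)`: a functor `F : 𝒜 ⥤ ℬ` with a natural transformation
`φ ⟶ F ⋙ ψ`. -/
structure Hom (X Y : Psh.{w}) : Type w where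
  base : X.base ⟶ Y.base
  psh : X.psh ⟶ base.toFunctor.op ⋙ Y.psh

instance : Category Psh.{w} where
  Hom := Hom
  id X := ⟨𝟙 _, 𝟙 X.psh⟩
  comp f g := ⟨f.base ≫ g.base, f.psh ≫ Functor.whiskerLeft f.base.toFunctor.op g.psh⟩

/-- The forgetful functor from presheaves to categories. -/
def forget : Psh.{w} ⥤ Cat.{w, w} where
  obj X := X.base
  map f := Hom.base f

/-- The external tensor product: `(a, b) ↦ φ a × ψ b` over the product category. -/
def tensor (X Y : Psh.{w}) : Psh.{w} where
  base := Cat.of (X.base × Y.base)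
  psh :=
    { obj p := X.psh.obj (op p.unop.1) × Y.psh.obj (op p.unop.2)
      map f := ↾fun x => (X.psh.map f.unop.1.op x.1, Y.psh.map f.unop.2.op x.2)
      map_id p := by
        ext x
        · exact X.psh.map_id_apply (op p.unop.1) x.1
        · exact Y.psh.map_id_apply (op p.unop.2) x.2
      map_comp f g := by
        ext x
        · exact X.psh.map_comp_apply f.unop.1.op g.unop.1.op x.1
        · exact Y.psh.map_comp_apply f.unop.2.op g.unop.2.op x.2 }

/-- The external residual: the presheaf `F ↦ ∀ a, φ a → ω (F a)` over the functor category, whose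
elements at `F` are the natural transformations `φ ⟶ F ⋙ ω`. Since the tensor product of categories
is the cartesian product, the same formula gives both the left residual of `Z` by `X` and the right
residual of `Z` by `X`. -/
def residual (X Z : Psh.{w}) : Psh.{w} where
  base := Cat.of (X.base ⥤ Z.base)
  psh :=
    { obj F := X.psh ⟶ F.unop.op ⋙ Z.psh
      map f := ↾fun x => x ≫ Functor.whiskerRight (NatTrans.op f.unop) Z.psh
      map_id F := by
        ext x a y
        exact Z.psh.map_id_apply (op (F.unop.obj a.unop)) (x.app a y)
      map_comp f g := by
        ext x a y
        exact Z.psh.map_comp_apply (f.unop.app a.unop).op (g.unop.app a.unop).op (x.app a y) }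

/-- Left currying of a functor. -/
def curryLBase {A B C : Cat.{w, w}} (F : Cat.of (A × B) ⟶ C) : B ⟶ Cat.of (A ⥤ C) :=
  (Functor.curry.obj (CategoryTheory.Prod.swap B A ⋙ F.toFunctor)).toCatHom

/-- Right currying of a functor. -/
def curryRBase {A B C : Cat.{w, w}} (F : Cat.of (A × B) ⟶ C) : A ⟶ Cat.of (B ⥤ C) :=
  (Functor.curry.obj F.toFunctor).toCatHom

theorem tensor_naturality {X Y Z : Psh.{w}} (f : tensor X Y ⟶ Z) {a a' : X.base} {b b' : Y.base}
    (u : a' ⟶ a) (v : b' ⟶ b) (x : X.psh.obj (op a)) (y : Y.psh.obj (op b)) :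
    (Hom.psh f).app (op (a', b')) (X.psh.map u.op x, Y.psh.map v.op y) =
      Z.psh.map (Quiver.Hom.op ((Hom.base f).toFunctor.map
        (X := ((a', b') : X.base × Y.base)) (Y := ((a, b) : X.base × Y.base)) (u, v)))
        ((Hom.psh f).app (op (a, b)) (x, y)) := by
  have h := (Hom.psh f).naturality
    (Quiver.Hom.op (X := ((a', b') : X.base × Y.base)) (Y := ((a, b) : X.base × Y.base)) (u, v))
  let p : X.psh.obj (op a) × Y.psh.obj (op b) := (x, y)
  exact ConcreteCategory.congr_hom h p

theorem tensor_naturality_left {X Y Z : Psh.{w}} (f : tensor X Y ⟶ Z) {a a' : X.base} {b : Y.base}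
    (u : a' ⟶ a) (x : X.psh.obj (op a)) (y : Y.psh.obj (op b)) :
    (Hom.psh f).app (op (a', b)) (X.psh.map u.op x, y) =
      Z.psh.map (Quiver.Hom.op ((Hom.base f).toFunctor.map
        (X := ((a', b) : X.base × Y.base)) (Y := ((a, b) : X.base × Y.base)) (u, 𝟙 b)))
        ((Hom.psh f).app (op (a, b)) (x, y)) :=
  Eq.trans (congrArg (fun z => (Hom.psh f).app (op (a', b)) (X.psh.map u.op x, z))
    (Y.psh.map_id_apply (op b) y).symm) (tensor_naturality f u (𝟙 b) x y)

theorem tensor_naturality_right {X Y Z : Psh.{w}} (f : tensor X Y ⟶ Z) {a : X.base} {b b' : Y.base}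
    (v : b' ⟶ b) (x : X.psh.obj (op a)) (y : Y.psh.obj (op b)) :
    (Hom.psh f).app (op (a, b')) (x, Y.psh.map v.op y) =
      Z.psh.map (Quiver.Hom.op ((Hom.base f).toFunctor.map
        (X := ((a, b') : X.base × Y.base)) (Y := ((a, b) : X.base × Y.base)) (𝟙 a, v)))
        ((Hom.psh f).app (op (a, b)) (x, y)) :=
  Eq.trans (congrArg (fun z => (Hom.psh f).app (op (a, b')) (z, Y.psh.map v.op y))
    (X.psh.map_id_apply (op a) x).symm) (tensor_naturality f (𝟙 a) v x y)

/-- Left currying: from `X ⊗ Y ⟶ Z` to `Y ⟶ X \ Z`. -/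
def curryL {X Y Z : Psh.{w}} (f : tensor X Y ⟶ Z) : Y ⟶ residual X Z where
  base := curryLBase (Hom.base f)
  psh :=
    { app b := ↾fun y =>
        { app a := ↾fun x => (Hom.psh f).app (op (a.unop, b.unop)) (x, y)
          naturality a a' u := by
            ext x
            exact tensor_naturality_left f u.unop x y }
      naturality b b' u := by
        ext y
        apply NatTrans.ext
        funext a
        ext x
        exact tensor_naturality_right f u.unop x y }

/-- Right currying: from `X ⊗ Y ⟶ Z` to `X ⟶ Z / Y`. -/
def curryR {X Y Z : Psh.{w}} (f : tensor X Y ⟶ Z) : X ⟶ residual Y Z where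
  base := curryRBase (Hom.base f)
  psh :=
    { app a := ↾fun x =>
        { app b := ↾fun y => (Hom.psh f).app (op (a.unop, b.unop)) (x, y)
          naturality b b' u := by
            ext y
            exact tensor_naturality_right f u.unop x y }
      naturality a a' u := by
        ext x
        apply NatTrans.ext
        funext b
        ext y
        exact tensor_naturality_left f u.unop x y }

/-- The pullback of a presheaf along a functor, by precomposition. -/
def pull {A : Cat.{w, w}} (Y : Psh.{w}) (F : A ⟶ Y.base) : Psh.{w} where
  base := A
  psh := F.toFunctor.op ⋙ Y.psh

/-- The structural morphism from the pullback. -/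
def pullProj {A : Cat.{w, w}} (Y : Psh.{w}) (F : A ⟶ Y.base) : pull Y F ⟶ Y where
  base := F
  psh := 𝟙 _

/-- The relation generating the coend `∃ a, ℬ(b, F a) × φ a`. -/
inductive PushRel {B : Cat.{w, w}} (X : Psh.{w}) (F : X.base ⟶ B) (b : B) :
    (Σ a : X.base, (b ⟶ F.toFunctor.obj a) × X.psh.obj (op a)) →
    (Σ a : X.base, (b ⟶ F.toFunctor.obj a) × X.psh.obj (op a)) → Prop
  | glue {a a' : X.base} (u : a ⟶ a') (f : b ⟶ F.toFunctor.obj a) (x : X.psh.obj (op a')) :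
    PushRel X F b ⟨a, f, X.psh.map u.op x⟩ ⟨a', f ≫ F.toFunctor.map u, x⟩

/-- The pushforward of a presheaf along a functor: the coend `b ↦ ∃ a, ℬ(b, F a) × φ a`. -/
def push {B : Cat.{w, w}} (X : Psh.{w}) (F : X.base ⟶ B) : Psh.{w} where
  base := B
  psh :=
    { obj b := Quot (PushRel X F b.unop)
      map g := ↾Quot.map (fun x => ⟨x.1, g.unop ≫ x.2.1, x.2.2⟩) (by
        rintro _ _ ⟨u, f, x⟩
        have := PushRel.glue (X := X) (F := F) u (g.unop ≫ f) x
        rwa [Category.assoc] at this)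
      map_id b := by
        ext x
        induction x using Quot.ind with | mk x => ?_
        exact congrArg (fun f => Quot.mk (PushRel X F b.unop) ⟨x.1, f, x.2.2⟩)
          (Category.id_comp x.2.1)
      map_comp {b b' b''} g h := by
        ext x
        induction x using Quot.ind with | mk x => ?_
        exact congrArg (fun f => Quot.mk (PushRel X F b''.unop) ⟨x.1, f, x.2.2⟩)
          (Category.assoc h.unop g.unop x.2.1) }

/-- The structural morphism to the pushforward. -/
def pushUnit {B : Cat.{w, w}} (X : Psh.{w}) (F : X.base ⟶ B) : X ⟶ push X F where
  base := F
  psh :=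
    { app a := ↾fun x => Quot.mk _ ⟨a.unop, 𝟙 _, x⟩
      naturality a a' u := by
        ext x
        refine (Quot.sound (PushRel.glue (X := X) (F := F) u.unop (𝟙 _) x)).trans ?_
        exact congrArg (fun f => Quot.mk (PushRel X F (F.toFunctor.obj a'.unop)) ⟨a.unop, f, x⟩)
          ((Category.id_comp _).trans (Category.comp_id _).symm) }

end Psh

/-! ### The positive representation -/

section Positive

variable {D : Type u₁} [Category.{v₁} D] {T : Type u₂} [Category.{v₂} T]

/-- Objects of the relative slice of `B`: a refinement `P` of some `A` with a term `c : A ⟶ B`. -/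
structure Slice (t : D ⥤ T) (B : T) : Type (max u₁ v₁ v₂) where
  ref : D
  term : t.obj ref ⟶ B

namespace Slice

/-- Morphisms `(P₁, c₁) ⟶ (P₂, c₂)`: derivations `α : P₁ ⟶ P₂` over some `e` with
`c₁ = e ≫ c₂`. -/
@[ext]
structure Hom {t : D ⥤ T} {B : T} (X Y : Slice t B) : Type (max u₁ v₁ v₂) where
  hom : X.ref ⟶ Y.ref
  w : X.term = t.map hom ≫ Y.term

instance (t : D ⥤ T) (B : T) : Category.{max u₁ v₁ v₂} (Slice t B) where
  Hom := Hom
  id X := ⟨𝟙 _, by simp⟩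
  comp f g := ⟨f.hom ≫ g.hom, by rw [f.w, g.w]; simp⟩
  id_comp f := Hom.ext (Category.id_comp _)
  comp_id f := Hom.ext (Category.comp_id _)
  assoc f g h := Hom.ext (Category.assoc _ _ _)

theorem eqToHom_hom {t : D ⥤ T} {B : T} {X Y : Slice t B} (h : X = Y) :
    Hom.hom (eqToHom h) = eqToHom (congrArg Slice.ref h) := by
  subst h; rfl

end Slice

/-- Postcomposition with `c`, as a functor between relative slices. -/
def sliceMap (t : D ⥤ T) {B C : T} (c : B ⟶ C) : Slice t B ⥤ Slice t C where
  obj X := ⟨X.ref, X.term ≫ c⟩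
  map f := ⟨f.hom, by rw [f.w, Category.assoc]⟩

/-- The relative slice functor `T ⥤ Cat`. -/
def posBase (t : D ⥤ T) : T ⥤ Cat.{max u₁ v₁ v₂, max u₁ v₁ v₂} where
  obj B := Cat.of (Slice t B)
  map c := (sliceMap t c).toCatHom
  map_id B := by
    apply Cat.Hom.ext
    refine CategoryTheory.Functor.ext
      (fun X => congrArg (Slice.mk X.ref) (Category.comp_id X.term)) (fun X Y f => ?_)
    apply Slice.Hom.ext
    refine Eq.trans ?_ (congrArg₂ (fun a b => a ≫ f.hom ≫ b)
      (Slice.eqToHom_hom _) (Slice.eqToHom_hom _)).symm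
    exact ((Category.id_comp _).trans (Category.comp_id f.hom)).symm
  map_comp {B₁ B₂ B₃} c d := by
    apply Cat.Hom.ext
    have h (X : Slice t B₁) :
        (sliceMap t (c ≫ d)).obj X = (sliceMap t c ⋙ sliceMap t d).obj X :=
      congrArg (Slice.mk X.ref) (Category.assoc X.term c d).symm
    refine CategoryTheory.Functor.ext (F := sliceMap t (c ≫ d))
      (G := sliceMap t c ⋙ sliceMap t d) h (fun X Y f => ?_)
    apply Slice.Hom.ext
    refine Eq.trans ?_ (congrArg₂ (fun a b => a ≫ f.hom ≫ b)
      (Slice.eqToHom_hom (h X)) (Slice.eqToHom_hom (h Y).symm)).symm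
    exact ((Category.id_comp _).trans (Category.comp_id f.hom)).symm

/-- Derivations of the judgment `P ⟹[c] Q`. -/
@[ext]
structure Deriv (t : D ⥤ T) {P : D} {B : T} (c : t.obj P ⟶ B) (Q : t.Fiber B) :
    Type (max u₁ v₁ v₂) where
  hom : P ⟶ Q.1
  lift : t.IsHomLift c hom

/-- The positive representation of a refinement `Q ⊏ B`: the presheaf on the relative slice of `B`
sending `(P, c)` to the set of derivations of `P ⟹[c] Q`. -/
def pos {t : D ⥤ T} {B : T} (Q : t.Fiber B) : Psh.{max u₁ v₁ v₂} where
  base := (posBase t).obj B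
  psh :=
    { obj X := Deriv t (Slice.term X.unop) Q
      map f := ↾fun α => ⟨Slice.Hom.hom f.unop ≫ α.hom, by
        have := α.lift
        rw [Slice.Hom.w f.unop]
        infer_instance⟩
      map_id X := by
        ext α
        exact Category.id_comp α.hom
      map_comp f g := by
        ext α
        exact Category.assoc (Slice.Hom.hom g.unop) (Slice.Hom.hom f.unop) α.hom }

/-- The action of the positive representation on derivations. -/
def posMap {t : D ⥤ T} {B C : T} {Q : t.Fiber B} {R : t.Fiber C} (c : B ⟶ C) (α : Q.1 ⟶ R.1)
    (h : t.IsHomLift c α) : pos Q ⟶ pos R where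
  base := (posBase t).map c
  psh :=
    { app X := ↾fun β => ⟨β.hom ≫ α, by
        have := β.lift
        exact inferInstanceAs (t.IsHomLift (Slice.term X.unop ≫ c) (β.hom ≫ α))⟩
      naturality X Y f := by
        ext β
        exact Deriv.ext (Category.assoc (Slice.Hom.hom f.unop) β.hom α) }

variable [MonoidalCategory D] [MonoidalCategory T] {t : D ⥤ T}

/-- The functor `m_{A,B}` sending `((P, c), (Q, d))` to `(P ⊗ Q, c ⊗ d)`. -/
def strBase (ht : IsMonoidalRefinement t) (A B : T) :
    Cat.of ((posBase t).obj A × (posBase t).obj B) ⟶ (posBase t).obj (A ⊗ B) :=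
  Functor.toCatHom
    { obj X := (⟨Slice.ref X.1 ⊗ Slice.ref X.2,
        eqToHom (ht.tensor_obj _ _) ≫ (Slice.term X.1 ⊗ₘ Slice.term X.2)⟩ : Slice t (A ⊗ B))
      map f := (⟨Slice.Hom.hom f.1 ⊗ₘ Slice.Hom.hom f.2, by
        rw [Slice.Hom.w f.1, Slice.Hom.w f.2, ht.tensor_map]
        simp⟩ : Slice.Hom _ _)
      map_id X := Slice.Hom.ext (id_tensorHom_id _ _)
      map_comp f g := Slice.Hom.ext (tensorHom_comp_tensorHom _ _ _ _).symm }

/-- The morphism `m_{P,Q}` of presheaves over `m_{A,B}`, sending a pair of derivations to their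
tensor product. -/
def str (ht : IsMonoidalRefinement t) {A B : T} (P : t.Fiber A) (Q : t.Fiber B) :
    Psh.tensor (pos P) (pos Q) ⟶ pos (ht.tensor P Q) where
  base := strBase ht A B
  psh :=
    { app X := ↾fun x => ⟨x.1.hom ⊗ₘ x.2.hom,
        ht.isHomLift_tensor _ _ _ _ x.1.lift x.2.lift⟩
      naturality X Y f := by
        ext x
        exact Deriv.ext (tensorHom_comp_tensorHom _ _ _ _).symm }

/-- The comparison functor from the slice of the left residual `E = A \ C`, with evaluation `plug`,
to the functor category between the slices of `A` and `C`. -/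
def costrLBase (ht : IsMonoidalRefinement t) {A C E : T} (plug : A ⊗ E ⟶ C) :
    (posBase t).obj E ⟶ Cat.of ((posBase t).obj A ⥤ (posBase t).obj C) :=
  Psh.curryLBase (strBase ht A E ≫ (posBase t).map plug)

/-- The comparison morphism of presheaves for a left residual `X = P \ R`, with evaluation `ev`
over `plug`. -/
def costrL (ht : IsMonoidalRefinement t) {A C E : T} {P : t.Fiber A} {R : t.Fiber C}
    {X : t.Fiber E} (plug : A ⊗ E ⟶ C) (ev : P.1 ⊗ X.1 ⟶ R.1) (h : t.IsHomLift plug ev) :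
    pos X ⟶ Psh.residual (pos P) (pos R) :=
  Psh.curryL (str ht P X ≫ posMap (Q := ht.tensor P X) plug ev h)

/-- The comparison functor from the slice of the right residual `E = C / B`, with evaluation
`plug`, to the functor category between the slices of `B` and `C`. -/
def costrRBase (ht : IsMonoidalRefinement t) {B C E : T} (plug : E ⊗ B ⟶ C) :
    (posBase t).obj E ⟶ Cat.of ((posBase t).obj B ⥤ (posBase t).obj C) :=
  Psh.curryRBase (strBase ht E B ≫ (posBase t).map plug)

/-- The comparison morphism of presheaves for a right residual `X = R / Q`, with evaluation `ev`
over `plug`. -/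
def costrR (ht : IsMonoidalRefinement t) {B C E : T} {Q : t.Fiber B} {R : t.Fiber C}
    {X : t.Fiber E} (plug : E ⊗ B ⟶ C) (ev : X.1 ⊗ Q.1 ⟶ R.1) (h : t.IsHomLift plug ev) :
    pos X ⟶ Psh.residual (pos Q) (pos R) :=
  Psh.curryR (str ht X Q ≫ posMap (Q := ht.tensor X Q) plug ev h)

end Positive

/-- A vertical isomorphism over `A`: a pair of mutually inverse derivations over `𝟙 A`. -/
structure VerticalIso {D : Type u₁} [Category.{v₁} D] {T : Type u₂} [Category.{v₂} T]
    (t : D ⥤ T) (A : T) (X Y : D) extends X ≅ Y where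
  hom_lift : t.IsHomLift (𝟙 A) hom
  inv_lift : t.IsHomLift (𝟙 A) inv

end RefSys

namespace RefSys

/-! ### Cartesian and cocartesian morphisms of presheaves -/

namespace Psh

/-! The presheaf `pos P` is representable: its representing object is `P` with the identity term,
and its universal element is `𝟙 P`. Everything follows from this by Yoneda.

For tensors, the coend defining the pushforward collapses at the pair of universal elements
(co-Yoneda). What remains is the set of slice morphisms into the tensor of the representing objects,
that is, the derivations of `P ⊗ Q`. By `isStronglyCocartesian_of_bijective` this bijection is all
that is needed.

For residuals, a natural transformation out of `pos P` is determined by its value at the universal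
element. At `(Y, c)` that value is a derivation `P ⊗ Y ⟶ R` over `(𝟙 ⊗ c) ≫ plug`, and the residual
in `D` factors it through a unique `g : Y ⟶ X`. That `g` lies over `c` is the point where
preservation of residuals enters (`isHomLift_of_leftResidual` and its mirror image). The comparison
is thus invertible over its base functor, which makes it cartesian (`isStronglyCartesian_of_isIso`).
-/

theorem isHomLift_forget_iff {X Y : Psh.{w}} (F : X.base ⟶ Y.base) (f : X ⟶ Y) :
    forget.IsHomLift F f ↔ Hom.base f = F :=
  ⟨fun h => (@IsHomLift.eq_of_isHomLift _ _ _ _ forget _ _ F f h).symm,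
    fun h => h ▸ (inferInstance : forget.IsHomLift (forget.map f) f)⟩

/-- The type of the presheaf component depends on the base functor; with a common base, the
heterogeneous equality coming from `Hom.mk` becomes an honest one. -/
theorem hom_psh_injective {X Y : Psh.{w}} (F : X.base ⟶ Y.base) :
    Function.Injective (fun α : X.psh ⟶ F.toFunctor.op ⋙ Y.psh => (⟨F, α⟩ : X ⟶ Y)) :=
  fun _ _ h => eq_of_heq (Hom.mk.inj h).2

/-- A morphism of presheaves over `F` which is invertible as a natural transformation is strongly
cartesian over `F`. -/
theorem isStronglyCartesian_of_isIso {X Y : Psh.{w}} (f : X ⟶ Y) [IsIso (Hom.psh f)] :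
    forget.IsStronglyCartesian (Hom.base f) f where
  toIsHomLift := (isHomLift_forget_iff _ f).2 rfl
  universal_property' {W} G k hk := by
    obtain ⟨b, κ⟩ := k
    obtain rfl : b = G ≫ Hom.base f := (isHomLift_forget_iff _ _).1 hk
    change W.base ⟶ X.base at G
    change W.psh ⟶ G.toFunctor.op ⋙ (Hom.base f).toFunctor.op ⋙ Y.psh at κ
    -- The factorization is forced: cancel `Hom.psh f`, whiskered along `G`, from `κ`.
    refine ⟨(⟨G, κ ≫ Functor.whiskerLeft G.toFunctor.op (inv (Hom.psh f))⟩ : Hom W X),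
      ⟨(isHomLift_forget_iff _ _).2 rfl, ?_⟩, ?_⟩
    · refine congrArg (Hom.mk (X := W) (Y := Y) (G ≫ Hom.base f)) ?_
      change (κ ≫ _) ≫ Functor.whiskerLeft G.toFunctor.op (Hom.psh f) = κ
      rw [Category.assoc, ← Functor.whiskerLeft_comp, IsIso.inv_hom_id, Functor.whiskerLeft_id']
      exact Category.comp_id κ
    · rintro ⟨b, η⟩ ⟨hb, h⟩
      obtain rfl : b = G := (isHomLift_forget_iff _ _).1 hb
      have h' : η ≫ Functor.whiskerLeft b.toFunctor.op (Hom.psh f) = κ :=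
        hom_psh_injective (X := W) (Y := Y) (b ≫ Hom.base f) h
      refine congrArg (Hom.mk (X := W) (Y := X) b) ?_
      rw [← h', Category.assoc, ← Functor.whiskerLeft_comp, IsIso.hom_inv_id,
        Functor.whiskerLeft_id']
      exact (Category.comp_id η).symm

/-- The vertical isomorphism induced by an isomorphism of presheaves. -/
def verticalIso {A : Cat.{w, w}} {φ ψ : Aᵒᵖ ⥤ Type w} (e : φ ≅ ψ) :
    VerticalIso forget A ⟨A, φ⟩ ⟨A, ψ⟩ where
  hom := ⟨𝟙 A, e.hom⟩
  inv := ⟨𝟙 A, e.inv⟩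
  hom_inv_id := congrArg (Hom.mk (X := ⟨A, φ⟩) (Y := ⟨A, φ⟩) (𝟙 A)) e.hom_inv_id
  inv_hom_id := congrArg (Hom.mk (X := ⟨A, ψ⟩) (Y := ⟨A, ψ⟩) (𝟙 A)) e.inv_hom_id
  hom_lift := (isHomLift_forget_iff (X := ⟨A, φ⟩) (Y := ⟨A, ψ⟩) _ _).2 rfl
  inv_lift := (isHomLift_forget_iff (X := ⟨A, ψ⟩) (Y := ⟨A, φ⟩) _ _).2 rfl

/-- The presheaf component of `f` already has the pulled-back presheaf as its target, so it serves
as the vertical isomorphism. -/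
theorem exists_verticalIso_pull {X Y : Psh.{w}} (f : X ⟶ Y) [IsIso (Hom.psh f)] :
    ∃ e : VerticalIso forget X.base X (pull Y (Hom.base f)),
      e.hom ≫ pullProj Y (Hom.base f) = f :=
  ⟨verticalIso (asIso (Hom.psh f)),
    congrArg (Hom.mk (X := X) (Y := Y) (Hom.base f)) (Category.comp_id (Hom.psh f))⟩

theorem naturality_apply {X Y : Psh.{w}} (f : X ⟶ Y) {a a' : X.base} (u : a ⟶ a')
    (x : X.psh.obj (op a')) :
    (Hom.psh f).app (op a) (X.psh.map u.op x) =
      Y.psh.map ((Hom.base f).toFunctor.map u).op ((Hom.psh f).app (op a') x) :=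
  ConcreteCategory.congr_hom ((Hom.psh f).naturality u.op) x

/-- The extension to the pushforward along `F` of a morphism of presheaves over `F ≫ G`. -/
def pushDesc {X Z : Psh.{w}} {B : Cat.{w, w}} (F : X.base ⟶ B) (G : B ⟶ Z.base)
    (κ : X.psh ⟶ (F ≫ G).toFunctor.op ⋙ Z.psh) : push X F ⟶ Z where
  base := G
  psh :=
    -- The class of `(a, f, x)` is the restriction along `f` of the image of `x` under `pushUnit`,
    -- so naturality dictates this value.
    { app b := ↾Quot.lift
        (fun x => Z.psh.map (G.toFunctor.map x.2.1).op (κ.app (op x.1) x.2.2)) (by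
          rintro _ _ ⟨u, f, x⟩
          have h := naturality_apply (⟨F ≫ G, κ⟩ : X ⟶ Z) u x
          dsimp only at h ⊢
          rw [h, ← Functor.map_comp_apply, G.toFunctor.map_comp]
          rfl)
      naturality b b' g := by
        ext x
        induction x using Quot.ind with | mk x => ?_
        refine Eq.trans (congrArg (fun k => Z.psh.map (Quiver.Hom.op k) (κ.app (op x.1) x.2.2))
          (G.toFunctor.map_comp (X := b'.unop) (Y := b.unop) g.unop x.2.1)) ?_
        exact Z.psh.map_comp_apply (G.toFunctor.map x.2.1).op
          (Quiver.Hom.op (G.toFunctor.map (X := b'.unop) (Y := b.unop) g.unop)) _ }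

theorem pushUnit_comp_pushDesc {X Z : Psh.{w}} {B : Cat.{w, w}} (F : X.base ⟶ B)
    (G : B ⟶ Z.base) (κ : X.psh ⟶ (F ≫ G).toFunctor.op ⋙ Z.psh) :
    pushUnit X F ≫ pushDesc F G κ = ⟨F ≫ G, κ⟩ := by
  refine congrArg (Hom.mk (X := X) (Y := Z) (F ≫ G)) ?_
  ext a x
  change Z.psh.map (G.toFunctor.map (𝟙 (F.toFunctor.obj a.unop))).op (κ.app a x) = κ.app a x
  rw [G.toFunctor.map_id]
  exact Z.psh.map_id_apply _ _

/-- Existence is `pushDesc`. Uniqueness holds because the classes with identity component generate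
the pushforward under restriction. -/
theorem pushUnit_isStronglyCocartesian {B : Cat.{w, w}} (X : Psh.{w}) (F : X.base ⟶ B) :
    forget.IsStronglyCocartesian F (pushUnit X F) where
  toIsHomLift := (isHomLift_forget_iff (Y := push X F) F _).2 rfl
  universal_property' {Z} G k hk := by
    obtain ⟨b, κ⟩ := k
    obtain rfl : b = F ≫ G := (isHomLift_forget_iff _ _).1 hk
    refine ⟨pushDesc F G κ, ⟨(isHomLift_forget_iff (X := push X F) _ _).2 rfl,
      pushUnit_comp_pushDesc F G κ⟩, ?_⟩
    rintro ⟨b, η⟩ ⟨hb, h⟩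
    obtain rfl : b = G := (isHomLift_forget_iff (X := push X F) _ _).1 hb
    have h' := hom_psh_injective (X := X) (Y := Z) (F ≫ b) h
    refine congrArg (Hom.mk (X := push X F) (Y := Z) b) ?_
    ext c x
    induction x using Quot.ind with | mk x => ?_
    obtain ⟨a, f, x⟩ := x
    have hx : η.app (op (F.toFunctor.obj a)) (Quot.mk _ ⟨a, 𝟙 _, x⟩) = κ.app (op a) x :=
      ConcreteCategory.congr_hom (NatTrans.congr_app h' (op a)) x
    have hn := naturality_apply (⟨b, η⟩ : push X F ⟶ Z) f (Quot.mk _ ⟨a, 𝟙 _, x⟩)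
    change _ = Z.psh.map (b.toFunctor.map f).op (κ.app (op a) x)
    rw [← hx]
    refine Eq.trans ?_ hn
    exact congrArg (fun g => η.app c (Quot.mk (PushRel X F c.unop) ⟨a, g, x⟩))
      (Category.comp_id f).symm

/-- If the values of `f` express the presheaf of its codomain as the coend defining the pushforward,
then `f` is strongly cocartesian. -/
theorem isStronglyCocartesian_of_bijective {X Y : Psh.{w}} (f : X ⟶ Y)
    (h : ∀ b : Y.base, Function.Bijective
      (Quot.lift (r := PushRel X (Hom.base f) b)
        (fun x => Y.psh.map x.2.1.op ((Hom.psh f).app (op x.1) x.2.2)) (by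
          rintro _ _ ⟨u, g, x⟩
          dsimp only
          rw [naturality_apply, ← Functor.map_comp_apply]
          rfl))) :
    forget.IsStronglyCocartesian (Hom.base f) f ∧
      ∃ e : VerticalIso forget Y.base (push X (Hom.base f)) Y,
        pushUnit X (Hom.base f) ≫ e.hom = f := by
  -- With `G = 𝟙`, the components of `pushDesc` are the maps that `h` assumes bijective.
  let k : push X (Hom.base f) ⟶ Y := pushDesc (Hom.base f) (𝟙 Y.base) (Hom.psh f)
  let φ : Y.baseᵒᵖ ⥤ Type w := (push X (Hom.base f)).psh
  let κ : φ ⟶ Y.psh := Hom.psh k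
  have : IsIso κ := by
    have (b : Y.baseᵒᵖ) : IsIso (κ.app b) := (isIso_iff_bijective _).2 (h b.unop)
    exact NatIso.isIso_of_isIso_app κ
  let i : φ ≅ Y.psh := asIso κ
  let e : VerticalIso forget Y.base (push X (Hom.base f)) Y := verticalIso i
  have he : pushUnit X (Hom.base f) ≫ e.hom = f :=
    pushUnit_comp_pushDesc (Hom.base f) (𝟙 Y.base) (Hom.psh f)
  refine ⟨?_, e, he⟩
  -- `f` is a strongly cocartesian morphism followed by a vertical isomorphism.
  have h₁ := pushUnit_isStronglyCocartesian X (Hom.base f)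
  have h₂ := e.hom_lift
  have h₃ := Functor.IsStronglyCocartesian.of_iso forget (𝟙 Y.base) e.toIso
  have h₄ := Functor.IsStronglyCocartesian.comp (p := forget) (f := Hom.base f) (g := 𝟙 Y.base)
    (φ := pushUnit X (Hom.base f)) (ψ := e.hom)
  rwa [he, Category.comp_id] at h₄

end Psh

/-! ### Representability of the positive presheaves -/

section Representability

variable {D : Type u₁} [Category.{v₁} D] {T : Type u₂} [Category.{v₂} T] {t : D ⥤ T}

/-- The object of the relative slice of `A` which represents the presheaf `pos P`. -/
def Slice.repr {A : T} (P : t.Fiber A) : Slice t A :=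
  ⟨P.1, eqToHom P.2⟩

/-- The universal element of the presheaf `pos P`. -/
def Deriv.univ {A : T} (P : t.Fiber A) : Deriv t (Slice.repr P).term P :=
  ⟨𝟙 P.1, IsHomLift.id_lift_eqToHom_domain P.2 rfl⟩

/-- The morphism to the representing object which classifies a derivation. -/
def Deriv.classify {A : T} {P : t.Fiber A} {S : Slice t A} (α : Deriv t S.term P) :
    S ⟶ Slice.repr P :=
  (⟨α.hom, by
    have := α.lift
    simpa [Slice.repr] using IsHomLift.fac t S.term α.hom⟩ : Slice.Hom S (Slice.repr P))

/-- This is the Yoneda step: combined with naturality or a coend relation, it reduces claims about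
all derivations to the universal one. -/
theorem Deriv.map_classify_univ {A : T} {P : t.Fiber A} {S : Slice t A} (α : Deriv t S.term P) :
    (pos P).psh.map (Quiver.Hom.op (X := (S : (pos P).base)) α.classify) (Deriv.univ P) = α :=
  Deriv.ext (Category.comp_id α.hom)

end Representability

/-! ### Tensor products and residuals -/

section Monoidal

variable {D : Type u₁} [Category.{v₁} D] {T : Type u₂} [Category.{v₂} T]
  [MonoidalCategory D] [MonoidalCategory T] {t : D ⥤ T}

/-- The morphism of slices classifying a derivation of a tensor product. -/
def Deriv.classifyTensor (ht : IsMonoidalRefinement t) {A B : T} {P : t.Fiber A} {Q : t.Fiber B}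
    {S : Slice t (A ⊗ B)} (γ : Deriv t S.term (ht.tensor P Q)) :
    S ⟶ (strBase ht A B).toFunctor.obj (Slice.repr P, Slice.repr Q) :=
  (⟨γ.hom, by
    have := γ.lift
    refine (IsHomLift.fac t S.term γ.hom).trans ?_
    obtain ⟨P, rfl⟩ := P
    obtain ⟨Q, rfl⟩ := Q
    change _ = t.map γ.hom ≫ eqToHom _ ≫ (𝟙 (t.obj P) ⊗ₘ 𝟙 (t.obj Q))
    simp⟩ : Slice.Hom S _)

theorem str_isStronglyCocartesian (ht : IsMonoidalRefinement t) {A B : T} (P : t.Fiber A)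
    (Q : t.Fiber B) :
    Psh.forget.IsStronglyCocartesian (strBase ht A B) (str ht P Q) ∧
      ∃ e : VerticalIso Psh.forget ((posBase t).obj (A ⊗ B))
          (Psh.push (Psh.tensor (pos P) (pos Q)) (strBase ht A B)) (pos (ht.tensor P Q)),
        Psh.pushUnit _ _ ≫ e.hom = str ht P Q := by
  refine Psh.isStronglyCocartesian_of_bijective (str ht P Q) fun S => ?_
  -- The inverse puts all of `γ` into the slice morphism and leaves universal elements in the
  -- presheaf slots.
  refine Function.bijective_iff_has_inverse.2 ⟨fun γ => Quot.mk _
    ⟨(Slice.repr P, Slice.repr Q), Deriv.classifyTensor ht γ, (Deriv.univ P, Deriv.univ Q)⟩, ?_, ?_⟩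
  · intro x
    induction x using Quot.ind with | mk x => ?_
    obtain ⟨⟨S₁, S₂⟩, f, α, β⟩ := x
    -- Gluing along the two classifying morphisms moves `α` and `β` into the slice component,
    -- leaving the universal elements.
    have h := Quot.sound (Psh.PushRel.glue (X := Psh.tensor (pos P) (pos Q))
      (F := strBase ht A B) (b := S)
      (a := (S₁, S₂)) (a' := (Slice.repr P, Slice.repr Q))
      (Deriv.classify α, Deriv.classify β) f (Deriv.univ P, Deriv.univ Q))
    refine h.symm.trans ?_
    refine congrArg (fun g => Quot.mk (Psh.PushRel (Psh.tensor (pos P) (pos Q))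
        (strBase ht A B) S) ⟨(S₁, S₂), f, g⟩) ?_
    exact Prod.ext (Deriv.map_classify_univ α) (Deriv.map_classify_univ β)
  · intro γ
    refine Deriv.ext ?_
    change γ.hom ≫ (𝟙 P.1 ⊗ₘ 𝟙 Q.1) = γ.hom
    rw [id_tensorHom_id]
    exact Category.comp_id _

/-- Both `c` and `t.map g` factor the same morphism through the image of `ev` under `t`. That image
is again a residual evaluation, so uniqueness in `T` gives `c = t.map g`. -/
theorem IsLogicalRefinement.isHomLift_of_leftResidual (ht : IsLogicalRefinement t) {A C E : T}
    {P : t.Fiber A} {R : t.Fiber C} {X : t.Fiber E} {plug : A ⊗ E ⟶ C} {ev : P.1 ⊗ X.1 ⟶ R.1}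
    (h : t.IsHomLift plug ev) (hev : IsLeftResidual ev) {Y : D} (c : t.obj Y ⟶ E) (g : Y ⟶ X.1)
    (hg : t.IsHomLift ((eqToHom (ht.tensor_obj P.1 Y) ≫ (eqToHom P.2 ⊗ₘ c)) ≫ plug)
      (P.1 ◁ g ≫ ev)) : t.IsHomLift c g := by
  obtain ⟨P, rfl⟩ := P
  obtain ⟨R, rfl⟩ := R
  obtain ⟨X, rfl⟩ := X
  dsimp only at ev h hev g hg
  obtain rfl : plug = eqToHom (ht.tensor_obj P X).symm ≫ t.map ev := by
    simpa using IsHomLift.fac t plug ev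
  have hg' := @IsHomLift.eq_of_isHomLift _ _ _ _ t _ _ _ _ hg
  obtain rfl : c = t.map g := by
    refine (ht.leftResidual ev hev (t.obj Y)
      (eqToHom (ht.tensor_obj P Y).symm ≫ t.map (P ◁ g ≫ ev))).unique ?_ ?_
    · rw [← hg']
      simp
    · rw [t.map_comp, ← id_tensorHom P g, ht.tensor_map]
      simp
  infer_instance

theorem IsLogicalRefinement.isHomLift_of_rightResidual (ht : IsLogicalRefinement t) {B C E : T}
    {Q : t.Fiber B} {R : t.Fiber C} {X : t.Fiber E} {plug : E ⊗ B ⟶ C} {ev : X.1 ⊗ Q.1 ⟶ R.1}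
    (h : t.IsHomLift plug ev) (hev : IsRightResidual ev) {Y : D} (c : t.obj Y ⟶ E) (g : Y ⟶ X.1)
    (hg : t.IsHomLift ((eqToHom (ht.tensor_obj Y Q.1) ≫ (c ⊗ₘ eqToHom Q.2)) ≫ plug)
      (g ▷ Q.1 ≫ ev)) : t.IsHomLift c g := by
  obtain ⟨Q, rfl⟩ := Q
  obtain ⟨R, rfl⟩ := R
  obtain ⟨X, rfl⟩ := X
  dsimp only at ev h hev g hg
  obtain rfl : plug = eqToHom (ht.tensor_obj X Q).symm ≫ t.map ev := by
    simpa using IsHomLift.fac t plug ev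
  have hg' := @IsHomLift.eq_of_isHomLift _ _ _ _ t _ _ _ _ hg
  obtain rfl : c = t.map g := by
    refine (ht.rightResidual ev hev (t.obj Y)
      (eqToHom (ht.tensor_obj Y Q).symm ≫ t.map (g ▷ Q ≫ ev))).unique ?_ ?_
    · rw [← hg']
      simp
    · rw [t.map_comp, ← tensorHom_id g Q, ht.tensor_map]
      simp
  infer_instance

theorem isIso_costrL_psh (ht : IsLogicalRefinement t) {A C E : T} {P : t.Fiber A} {R : t.Fiber C}
    {X : t.Fiber E} (plug : A ⊗ E ⟶ C) (ev : P.1 ⊗ X.1 ⟶ R.1) (h : t.IsHomLift plug ev)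
    (hev : IsLeftResidual ev) :
    IsIso (Psh.Hom.psh (costrL ht.toIsMonoidalRefinement plug ev h)) := by
  have (Y : (pos X).baseᵒᵖ) : IsIso ((Psh.Hom.psh (costrL ht.toIsMonoidalRefinement plug ev h)).app Y) := by
    rw [isIso_iff_bijective]
    refine ⟨fun α β hαβ => ?_, fun η => ?_⟩
    -- Comparing at the universal element turns injectivity into uniqueness of factorization through
    -- `ev`.
    · have h₁ := ConcreteCategory.congr_hom
        (NatTrans.congr_app hαβ (op (Slice.repr P))) (Deriv.univ P)
      have h₂ : (𝟙 P.1 ⊗ₘ α.hom) ≫ ev = (𝟙 P.1 ⊗ₘ β.hom) ≫ ev := congrArg Deriv.hom h₁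
      rw [id_tensorHom, id_tensorHom] at h₂
      exact Deriv.ext ((hev _ _).unique h₂ rfl)
    -- `f` is the derivation corresponding to `η` under Yoneda; its factor `g` is the preimage
    -- sought.
    · let f := NatTrans.app η (op (Slice.repr P)) (Deriv.univ P)
      obtain ⟨g, hg, -⟩ := hev _ f.hom
      refine ⟨⟨g, ht.isHomLift_of_leftResidual h hev _ g ?_⟩, ?_⟩
      · rw [hg]
        exact f.lift
      · apply NatTrans.ext
        funext S
        ext β
        -- Naturality along the classifying morphism of `β` computes `η` at `β` from `f`;
        -- interchange then turns both sides into `(β.hom ⊗ₘ g) ≫ ev`.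
        have hn := ConcreteCategory.congr_hom
          (NatTrans.naturality η (Quiver.Hom.op (Deriv.classify β))) (Deriv.univ P)
        rw [← Deriv.map_classify_univ β]
        refine Eq.trans (Deriv.ext ?_) hn.symm
        change ((β.hom ≫ 𝟙 P.1) ⊗ₘ g) ≫ ev = (β.hom ⊗ₘ 𝟙 _) ≫ f.hom
        rw [← hg, Category.comp_id, ← id_tensorHom, tensorHom_comp_tensorHom_assoc,
          Category.comp_id, Category.id_comp]
  exact NatIso.isIso_of_isIso_app _

/-- The same Yoneda argument as for `isIso_costrL_psh`, with the universal element in the right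
tensor factor. -/
theorem isIso_costrR_psh (ht : IsLogicalRefinement t) {B C E : T} {Q : t.Fiber B} {R : t.Fiber C}
    {X : t.Fiber E} (plug : E ⊗ B ⟶ C) (ev : X.1 ⊗ Q.1 ⟶ R.1) (h : t.IsHomLift plug ev)
    (hev : IsRightResidual ev) :
    IsIso (Psh.Hom.psh (costrR ht.toIsMonoidalRefinement plug ev h)) := by
  have (Y : (pos X).baseᵒᵖ) : IsIso ((Psh.Hom.psh (costrR ht.toIsMonoidalRefinement plug ev h)).app Y) := by
    rw [isIso_iff_bijective]
    refine ⟨fun α β hαβ => ?_, fun η => ?_⟩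
    · have h₁ := ConcreteCategory.congr_hom
        (NatTrans.congr_app hαβ (op (Slice.repr Q))) (Deriv.univ Q)
      have h₂ : (α.hom ⊗ₘ 𝟙 Q.1) ≫ ev = (β.hom ⊗ₘ 𝟙 Q.1) ≫ ev := congrArg Deriv.hom h₁
      rw [tensorHom_id, tensorHom_id] at h₂
      exact Deriv.ext ((hev _ _).unique h₂ rfl)
    · let f := NatTrans.app η (op (Slice.repr Q)) (Deriv.univ Q)
      obtain ⟨g, hg, -⟩ := hev _ f.hom
      refine ⟨⟨g, ht.isHomLift_of_rightResidual h hev _ g ?_⟩, ?_⟩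
      · rw [hg]
        exact f.lift
      · apply NatTrans.ext
        funext S
        ext β
        have hn := ConcreteCategory.congr_hom
          (NatTrans.naturality η (Quiver.Hom.op (Deriv.classify β))) (Deriv.univ Q)
        rw [← Deriv.map_classify_univ β]
        refine Eq.trans (Deriv.ext ?_) hn.symm
        change (g ⊗ₘ (β.hom ≫ 𝟙 Q.1)) ≫ ev = (𝟙 _ ⊗ₘ β.hom) ≫ f.hom
        rw [← hg, Category.comp_id, ← tensorHom_id, tensorHom_comp_tensorHom_assoc,
          Category.comp_id, Category.id_comp]
  exact NatIso.isIso_of_isIso_app _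

end Monoidal

end RefSys

theorem mainTheorem3 {D : Type u₁} [Category.{v₁} D] {T : Type u₂} [Category.{v₂} T]
    [MonoidalCategory D] [MonoidalCategory T] (t : D ⥤ T) (ht : RefSys.IsLogicalRefinement t)
    {A B C : T} (P : t.Fiber A) (Q : t.Fiber B) (R : t.Fiber C) :
    (Functor.IsStronglyCocartesian RefSys.Psh.forget
        (RefSys.strBase ht.toIsMonoidalRefinement A B)
        (RefSys.str ht.toIsMonoidalRefinement P Q) ∧
      ∃ e : RefSys.VerticalIso RefSys.Psh.forget ((RefSys.posBase t).obj (A ⊗ B))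
          (RefSys.Psh.push (RefSys.Psh.tensor (RefSys.pos P) (RefSys.pos Q))
            (RefSys.strBase ht.toIsMonoidalRefinement A B))
          (RefSys.pos (ht.toIsMonoidalRefinement.tensor P Q)),
        RefSys.Psh.pushUnit _ _ ≫ e.hom = RefSys.str ht.toIsMonoidalRefinement P Q) ∧
    (∀ {E : T} (X : t.Fiber E) (plug : A ⊗ E ⟶ C) (ev : P.1 ⊗ X.1 ⟶ R.1)
        (h : t.IsHomLift plug ev), RefSys.IsLeftResidual ev →
      Functor.IsStronglyCartesian RefSys.Psh.forget
        (RefSys.costrLBase ht.toIsMonoidalRefinement plug)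
        (RefSys.costrL ht.toIsMonoidalRefinement plug ev h) ∧
      ∃ e : RefSys.VerticalIso RefSys.Psh.forget ((RefSys.posBase t).obj E)
          (RefSys.pos X)
          (RefSys.Psh.pull (RefSys.Psh.residual (RefSys.pos P) (RefSys.pos R))
            (RefSys.costrLBase ht.toIsMonoidalRefinement plug)),
        e.hom ≫ RefSys.Psh.pullProj _ _ =
          RefSys.costrL ht.toIsMonoidalRefinement plug ev h) ∧
    (∀ {E : T} (X : t.Fiber E) (plug : E ⊗ B ⟶ C) (ev : X.1 ⊗ Q.1 ⟶ R.1)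
        (h : t.IsHomLift plug ev), RefSys.IsRightResidual ev →
      Functor.IsStronglyCartesian RefSys.Psh.forget
        (RefSys.costrRBase ht.toIsMonoidalRefinement plug)
        (RefSys.costrR ht.toIsMonoidalRefinement plug ev h) ∧
      ∃ e : RefSys.VerticalIso RefSys.Psh.forget ((RefSys.posBase t).obj E)
          (RefSys.pos X)
          (RefSys.Psh.pull (RefSys.Psh.residual (RefSys.pos Q) (RefSys.pos R))
            (RefSys.costrRBase ht.toIsMonoidalRefinement plug)),
        e.hom ≫ RefSys.Psh.pullProj _ _ =
          RefSys.costrR ht.toIsMonoidalRefinement plug ev h) := by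
  refine ⟨RefSys.str_isStronglyCocartesian _ P Q, fun X plug ev h hev => ?_,
    fun X plug ev h hev => ?_⟩
  · have := RefSys.isIso_costrL_psh ht plug ev h hev
    -- The base component of `costrL` unfolds to `costrLBase`, so the general results apply without
    -- transport.
    exact ⟨RefSys.Psh.isStronglyCartesian_of_isIso (RefSys.costrL _ plug ev h),
      RefSys.Psh.exists_verticalIso_pull (RefSys.costrL _ plug ev h)⟩
  · have := RefSys.isIso_costrR_psh ht plug ev h hev
    exact ⟨RefSys.Psh.isStronglyCartesian_of_isIso (RefSys.costrR _ plug ev h),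
      RefSys.Psh.exists_verticalIso_pull (RefSys.costrR _ plug ev h)⟩
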